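/- **Definitions.** Let $\kappa$ be an infinite cardinal. *Ideals and rank.* An ideal $J$ on $\kappa$ is a proper ideal of subsets of $\kappa$; it is $\aleph_1$-complete if it is closed under countable unions. For $f,g:\kappa\to\mathrm{On}$ write $g<_J f$ if $\{i<\kappa : \neg(g(i)<f(i))\}\in J$. If $J$ is $\aleph_1$-complete then $<_J$ is well founded, and the Galvin–Hajnal rank is $\|f\|_J=\sup\{\|g\|_J+1 : g<_J f\}$; $\|\gamma\|_J$ is the rank of the constant function with value $\gamma$. *The ordinal $\delta_2$.* For an ordinal $\gamma$, $\delta_2(\gamma,\kappa)$ is the least ordinal $\delta$ such that the following holds for every first-order theory $T$ with $|T|\le\kappa$, in a language with at most $\kappa$ symbols containing a unary predicate $P$ and a binary predicate $<$, such that $T\vdash$ "$<$ is a linear order", and for every set $\Gamma$ of (finitary, not necessarily complete) types over the empty set with $|\Gamma|\le\kappa$: *if* for every $\delta'<\delta$ there is a model $M$ of $T$ omitting all types in $\Gamma$ such that $(P^M,<^M)$ is well ordered of order type $<\gamma$ and $(M\setminus P^M,<^M)$ is well ordered of order type $\ge\delta'$, *then* there is a model $N$ of $T$ omitting all types in $\Gamma$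 such that $(P^N,<^N)$ is well ordered of order type $<\kappa^+$ and $(N\setminus P^N,<^N)$ is not well ordered. **Theorem.** Let $J$ be an $\aleph_1$-complete ideal on $\kappa$ satisfying at least one of the following conditions: 1. $J$ is generated, as an ideal, by at most $\kappa$ sets; that is, there is a family $G$ of at most $\kappa$ subsets of $\kappa$ such that $A\in J$ iff $A$ is contained in a union of finitely many members of $G$; 2. ($\bigotimes_J$) there are a structure $\mathcal B$ with universe $\kappa$ in a language with at most $\kappa$ symbols and a sentence $\psi(P)\in L_{\kappa^+,\omega}$ in the language $L(\mathcal B)\cup\{P\}$, $P$ a new unary predicate, such that for every $A\subseteq\kappa$: $A\in J\iff\langle\mathcal B,A\rangle\models\psi(P)$; 3. ($\bigotimes^-_J$) there are $\mathcal B$ and $\psi(P)$ as in 2 such that for every $A\subseteq\kappa$: $A\in J$ iff there is $A'\supseteq A$ with $\langle\mathcal B,A'\rangle\models\psi(P)$ (in particular every such $A'$ belongs to $J$). Then for every ordinal $\gamma>\kappa$, $$\|\gamma\|_J<\delta_2(\gamma+1,\kappa),$$ that is, $\|\gamma\|_J$ is strictly below the ordinal defined like $\delta_2(\gamma,\kappa)$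 but with models $M$ in which $P^M$ has order type $\le\gamma$. Moreover, if $\gamma$ is a successor ordinal or $\operatorname{cf}(\gamma)>\kappa$, then $$\|\gamma\|_J<\delta_2(\gamma,\kappa).$$ -/

import Mathlib

open Cardinal
open scoped FirstOrder

universe u

namespace GalvinHajnal

/-! ### Ideals and the Galvin–Hajnal rank -/

/-- A proper ideal of subsets of `X` that is closed under countable unions
(an `ℵ₁`-complete ideal on `X`). -/
structure IsAlephOneComplete {X : Type u} (J : Order.Ideal (Set X)) : Prop where
  proper : Set.univ ∉ J
  iUnion_mem : ∀ s : ℕ → Set X, (∀ n, s n ∈ J) → (⋃ n, s n) ∈ J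

/-- `g <_J f`: the set of points at which `g < f` fails belongs to `J`. -/
def LtMod {X : Type u} (J : Order.Ideal (Set X)) (g f : X → Ordinal.{u}) : Prop :=
  {x | ¬ g x < f x} ∈ J

theorem wellFounded_ltMod {X : Type u} {J : Order.Ideal (Set X)} (hJ : IsAlephOneComplete J) :
    WellFounded (LtMod J) := by
  rw [wellFounded_iff_isEmpty_descending_chain]
  refine ⟨fun ⟨f, hf⟩ => ?_⟩
  have h := hJ.iUnion_mem (fun n => {x | ¬ f (n + 1) x < f n x}) hf
  by_cases hu : (⋃ n, {x | ¬ f (n + 1) x < f n x}) = Set.univ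
  · exact hJ.proper (hu ▸ h)
  · obtain ⟨x, hx⟩ := (Set.ne_univ_iff_exists_notMem _).1 hu
    simp only [Set.mem_iUnion, Set.mem_ofPred_eq, not_exists, not_not] at hx
    exact (wellFounded_iff_isEmpty_descending_chain.1
      (wellFounded_lt (α := Ordinal.{u}))).false ⟨fun n => f n x, hx⟩

/-- The Galvin–Hajnal rank `‖f‖_J = sup {‖g‖_J + 1 : g <_J f}`
(see `rank_eq` for the recursion and `bddAbove_rank` for the existence of the supremum). -/
noncomputable def rank {X : Type u} (J : Order.Ideal (Set X)) (hJ : IsAlephOneComplete J) :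
    (X → Ordinal.{u}) → Ordinal.{u} :=
  (wellFounded_ltMod hJ).fix fun f ih =>
    sSup {o | ∃ (g : X → Ordinal.{u}) (h : LtMod J g f), o = Order.succ (ih g h)}

theorem rank_eq {X : Type u} (J : Order.Ideal (Set X)) (hJ : IsAlephOneComplete J)
    (f : X → Ordinal.{u}) :
    rank J hJ f = sSup {o | ∃ g, LtMod J g f ∧ o = Order.succ (rank J hJ g)} := by
  rw [rank, WellFounded.fix_eq]
  simp only [exists_prop]

theorem bddAbove_rank {X : Type u} (J : Order.Ideal (Set X)) (hJ : IsAlephOneComplete J)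
    (f : X → Ordinal.{u}) :
    BddAbove {o | ∃ g, LtMod J g f ∧ o = Order.succ (rank J hJ g)} := by
  -- the rank depends only on the class of the function modulo `J`
  have key : ∀ g g' : X → Ordinal.{u}, {x | g x ≠ g' x} ∈ J → rank J hJ g = rank J hJ g' := by
    intro g g' h
    rw [rank_eq, rank_eq]
    congr 1
    ext o
    refine exists_congr fun k => and_congr_left fun _ => ?_
    constructor
    · intro hk
      refine J.lower ?_ (Order.Ideal.sup_mem hk h)
      intro x hx
      by_cases hgx : g x = g' x
      · left; simpa [hgx] using hx
      · right; exact hgx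
    · intro hk
      refine J.lower ?_ (Order.Ideal.sup_mem hk h)
      intro x hx
      by_cases hgx : g x = g' x
      · left; simpa [← hgx] using hx
      · right; exact hgx
  have hsub : {o | ∃ g, LtMod J g f ∧ o = Order.succ (rank J hJ g)} ⊆
      Set.range fun g : (∀ x, Set.Iic (f x)) =>
        Order.succ (rank J hJ fun x => (g x : Ordinal.{u})) := by
    rintro o ⟨g, hg, rfl⟩
    refine ⟨fun x => ⟨min (g x) (f x), Set.mem_Iic.2 (min_le_right _ _)⟩, ?_⟩
    refine congrArg Order.succ (key _ _ (J.lower ?_ hg))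
    intro x hx hlt
    exact hx (min_eq_left hlt.le)
  exact (Ordinal.bddAbove_of_small (s := Set.range _)).mono hsub

/-! ### Infinitary formulas -/

/-- Formulas of `L_{κ⁺,ω}` with free variables among `x₀, …, x_{n-1}`: conjunctions of at most `κ`
formulas and quantification over single variables (disjunctions and `∃` through negation). -/
inductive InfFormula (L : FirstOrder.Language.{u, u}) (κ : Cardinal.{u}) : ℕ → Type (u + 1)
  | equal {n : ℕ} (s t : L.Term (Fin n)) : InfFormula L κ n
  | rel {n l : ℕ} (R : L.Relations l) (ts : Fin l → L.Term (Fin n)) : InfFormula L κ n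
  | neg {n : ℕ} (φ : InfFormula L κ n) : InfFormula L κ n
  | conj {n : ℕ} {ι : Type u} (hι : #ι ≤ κ) (φ : ι → InfFormula L κ n) : InfFormula L κ n
  | all {n : ℕ} (φ : InfFormula L κ (n + 1)) : InfFormula L κ n

/-- Satisfaction of a formula of `L_{κ⁺,ω}` in a structure under an assignment. -/
def InfFormula.Realize {L : FirstOrder.Language.{u, u}} {κ : Cardinal.{u}} {M : Type u} [L.Structure M] :
    {n : ℕ} → InfFormula L κ n → (Fin n → M) → Prop
  | _, .equal s t, v => s.realize v = t.realize v
  | _, .rel R ts, v => FirstOrder.Language.Structure.RelMap R fun i => (ts i).realize v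
  | _, .neg φ, v => ¬ φ.Realize v
  | _, .conj _ φ, v => ∀ i, (φ i).Realize v
  | _, .all φ, v => ∀ x : M, φ.Realize (Fin.snoc v x : Fin (_ + 1) → M)

/-- The relation symbols of the language `{P}`. -/
inductive PredSymbol : ℕ → Type u
  | P : PredSymbol 1

/-- The language with one unary predicate symbol `P`. -/
def predLanguage : FirstOrder.Language.{u, u} := ⟨fun _ => PEmpty, PredSymbol⟩

/-- The set `A` as the interpretation of `P`. -/
abbrev predStructure {X : Type u} (A : Set X) : predLanguage.{u}.Structure X where
  funMap := fun f => PEmpty.elim f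
  RelMap := fun R => match R with
    | .P => fun v => v 0 ∈ A

/-- `⟨B, A⟩ ⊨ ψ(P)`, for a structure `B` with universe `X` and a sentence `ψ(P)` of
`L_{κ⁺,ω}` in the language `L(B) ∪ {P}`. -/
def ExpansionModels {L : FirstOrder.Language.{u, u}} {κ : Cardinal.{u}} {X : Type u} (B : L.Structure X)
    (A : Set X) (ψ : InfFormula (L.sum predLanguage.{u}) κ 0) : Prop :=
  letI := B
  letI := predStructure A
  ψ.Realize (Fin.elim0 : Fin 0 → X)

/-! ### Conditions on the ideal -/

/-- `J` is generated, as an ideal, by at most `κ` sets. -/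
def IsGeneratedBy {X : Type u} (κ : Cardinal.{u}) (J : Order.Ideal (Set X)) : Prop :=
  ∃ G : Set (Set X), #G ≤ κ ∧ ∀ A, A ∈ J ↔ ∃ F ⊆ G, F.Finite ∧ A ⊆ ⋃₀ F

/-- For some structure `B` on `X` in a language with at most `κ` symbols and some sentence `ψ(P)`
of `L_{κ⁺,ω}`: `A ∈ J` iff `⟨B, A⟩ ⊨ ψ(P)`. -/
def IsDefinable {X : Type u} (κ : Cardinal.{u}) (J : Order.Ideal (Set X)) : Prop :=
  ∃ (L : FirstOrder.Language.{u, u}) (_ : L.card ≤ κ) (B : L.Structure X)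
    (ψ : InfFormula (L.sum predLanguage.{u}) κ 0),
    ∀ A : Set X, A ∈ J ↔ ExpansionModels B A ψ

/-- For some structure `B` on `X` in a language with at most `κ` symbols and some sentence `ψ(P)`
of `L_{κ⁺,ω}`: `A ∈ J` iff `⟨B, A'⟩ ⊨ ψ(P)` for some `A' ⊇ A` (so every such `A'` is in `J`). -/
def IsCofinallyDefinable {X : Type u} (κ : Cardinal.{u}) (J : Order.Ideal (Set X)) : Prop :=
  ∃ (L : FirstOrder.Language.{u, u}) (_ : L.card ≤ κ) (B : L.Structure X)
    (ψ : InfFormula (L.sum predLanguage.{u}) κ 0),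
    ∀ A : Set X, A ∈ J ↔ ∃ A' : Set X, A ⊆ A' ∧ ExpansionModels B A' ψ

/-! ### The ordinal `δ₂(γ, κ)` -/

/-- A (not necessarily complete) finitary type over the empty set. -/
abbrev PartialType (L : FirstOrder.Language.{u, u}) : Type u :=
  Σ n : ℕ, Set (L.Formula (Fin n))

/-- `M ∈ EC(T, Γ)`: `M` is a (nonempty) model of `T` that omits every type in `Γ`. -/
def MemEC {L : FirstOrder.Language.{u, u}} (T : L.Theory) (Γ : Set (PartialType L))
    (M : Type u) [L.Structure M] : Prop :=
  Nonempty M ∧ M ⊨ T ∧ ∀ p ∈ Γ, ∀ v : Fin p.1 → M, ∃ φ ∈ p.2, ¬ φ.Realize v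

/-- The interpretation `<^M` of a binary relation symbol. -/
def ltRel {L : FirstOrder.Language.{u, u}} (lt : L.Relations 2) (M : Type u) [L.Structure M] (x y : M) :
    Prop :=
  FirstOrder.Language.Structure.RelMap lt ![x, y]

/-- The interpretation `P^M` of a unary predicate symbol. -/
def predSet {L : FirstOrder.Language.{u, u}} (P : L.Relations 1) (M : Type u) [L.Structure M] : Set M :=
  {x | FirstOrder.Language.Structure.RelMap P ![x]}

/-- `T ⊢ "< is a (strict) linear order"`; by completeness this is said about the models of `T`. -/
def ProvesLinearOrder {L : FirstOrder.Language.{u, u}} (T : L.Theory) (lt : L.Relations 2) : Prop :=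
  ∀ (M : Type u) [L.Structure M] [Nonempty M], M ⊨ T → IsStrictTotalOrder M (ltRel lt M)

/-- The property of `δ` of which `δ₂(γ, κ)` is the least instance. The language of `T` has at most
`κ` symbols, which for infinite `κ` gives `|T| ≤ κ`. The order type of a set is only compared with
an ordinal if the set is well ordered. -/
def DeltaTwoProperty (γ : Ordinal.{u}) (κ : Cardinal.{u}) (δ : Ordinal.{u}) : Prop :=
  ∀ (L : FirstOrder.Language.{u, u}) (T : L.Theory) (lt : L.Relations 2) (P : L.Relations 1)
    (Γ : Set (PartialType L)),
    L.card ≤ κ → #Γ ≤ κ → ProvesLinearOrder T lt →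
    (∀ δ' < δ, ∃ (M : Type u) (_ : L.Structure M), MemEC T Γ M ∧
      (∃ _ : IsWellOrder (predSet P M) (Subrel (ltRel lt M) (· ∈ predSet P M)),
        Ordinal.type (Subrel (ltRel lt M) (· ∈ predSet P M)) < γ) ∧
      (∃ _ : IsWellOrder ↑(predSet P M)ᶜ (Subrel (ltRel lt M) (· ∈ (predSet P M)ᶜ)),
        δ' ≤ Ordinal.type (Subrel (ltRel lt M) (· ∈ (predSet P M)ᶜ)))) →
    ∃ (N : Type u) (_ : L.Structure N), MemEC T Γ N ∧
      (∃ _ : IsWellOrder (predSet P N) (Subrel (ltRel lt N) (· ∈ predSet P N)),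
        Ordinal.type (Subrel (ltRel lt N) (· ∈ predSet P N)) < (Order.succ κ).ord) ∧
      ¬ IsWellOrder ↑(predSet P N)ᶜ (Subrel (ltRel lt N) (· ∈ (predSet P N)ᶜ))

/-- `δ₂(γ, κ)`: the least `δ` with `DeltaTwoProperty γ κ δ` (formally `⊤` if there were none). -/
noncomputable def deltaTwo (γ : Ordinal.{u}) (κ : Cardinal.{u}) : WithTop Ordinal.{u} :=
  sInf {d | ∃ δ : Ordinal.{u}, d = (δ : WithTop Ordinal.{u}) ∧ DeltaTwoProperty γ κ δ}

end GalvinHajnal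

namespace GalvinHajnal

/-! ### Infinitary clauses -/

/-! The proof refutes `DeltaTwoProperty` at the rank of `γ` by one theory and one set of types,
whose models describe iterated descent below a constant function modulo `J`. Omitting a type asserts
an infinite disjunction, so at most `κ` omitted types can enforce at most `κ` infinitary clauses.
Each of the three conditions makes membership in `J` the projection of the solutions of such a
system (`isClausal_ideal`), the auxiliary truth values becoming extra predicates. The models are
linear orders in which each finite sequence `v` and point `i` carry a value `F i v` in `P`. For a
descending sequence of at least two elements outside `P`, the points at which the value fails to
drop when the last element is added must form a set of `J`. If `P` is well ordered, so is its
complement: along an infinite descent the countably many failure sets have their union in `J`, so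
some point avoids them all, and its values descend forever in `P` (`isWellOrder_compl_of_memEC`).
Thus the conclusion of the property always fails. Its premise holds: on `β` followed by the rank of
`β`, start from the constant function `β` and at each ordinal `a` of the sequence move to a
`<_J`-smaller function of rank at least `a` (`exists_model`). For `γ + 1` take `β = γ`; in the
second claim smaller `β` suffice (`exists_le_rank_const`). -/

/-- The sets `A` and `w`, as truth values of the variables `X ⊕ Θ`, satisfy all the clauses. -/
def SatClauses {X Θ Ξ : Type u} (cl : Ξ → Set ((X ⊕ Θ) × Bool)) (A : Set X) (w : Set Θ) : Prop :=
  ∀ ξ, ∃ l ∈ cl ξ, (Sum.elim (· ∈ A) (· ∈ w) l.1 ↔ l.2 = true)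

/-- A family of subsets of `X` is clausal if it is the projection of the set of solutions of at most
`κ` infinitary clauses with at most `κ` auxiliary variables. -/
def IsClausal {X : Type u} (κ : Cardinal.{u}) (D : Set X → Prop) : Prop :=
  ∃ (Θ Ξ : Type u) (_ : #Θ ≤ κ) (_ : #Ξ ≤ κ) (cl : Ξ → Set ((X ⊕ Θ) × Bool)),
    ∀ A, D A ↔ ∃ w, SatClauses cl A w

section Clausal

variable {X : Type u} {κ : Cardinal.{u}}

theorem mk_sigma_le (hκ : ℵ₀ ≤ κ) {ι : Type u} (hι : #ι ≤ κ) {Y : ι → Type u}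
    (hY : ∀ i, #(Y i) ≤ κ) : #(Σ i, Y i) ≤ κ := by
  rw [mk_sigma]
  refine (sum_le_mk_mul_iSup _).trans ?_
  exact (mul_le_mul' hι (ciSup_le' hY)).trans (mul_eq_self hκ).le

theorem IsClausal.congr {D E : Set X → Prop} (hD : IsClausal κ D) (h : ∀ A, E A ↔ D A) :
    IsClausal κ E := by
  obtain rfl : E = D := funext fun A => propext (h A)
  exact hD

/-- The systems are put side by side on disjoint copies of their auxiliary variables. -/
theorem isClausal_conj (hκ : ℵ₀ ≤ κ) {ι : Type u} (hι : #ι ≤ κ) {D : ι → Set X → Prop}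
    (hD : ∀ i, IsClausal κ (D i)) : IsClausal κ fun A => ∀ i, D i A := by
  choose Θ Ξ hΘ hΞ cl hcl using hD
  refine ⟨Σ i, Θ i, Σ i, Ξ i, mk_sigma_le hκ hι hΘ, mk_sigma_le hκ hι hΞ,
    fun p => {l | ∃ m ∈ cl p.1 p.2, l = (Sum.map id (Sigma.mk p.1) m.1, m.2)}, fun A => ?_⟩
  constructor
  · intro h
    choose w hw using fun i => (hcl i A).1 (h i)
    refine ⟨{p | p.2 ∈ w p.1}, fun ⟨i, ξ⟩ => ?_⟩
    obtain ⟨⟨m, b⟩, hm, hb⟩ := hw i ξ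
    refine ⟨_, ⟨_, hm, rfl⟩, ?_⟩
    cases m <;> exact hb
  · rintro ⟨w, hw⟩ i
    refine (hcl i A).2 ⟨{t | (⟨i, t⟩ : Σ i, Θ i) ∈ w}, fun ξ => ?_⟩
    obtain ⟨_, ⟨⟨m, b⟩, hm, rfl⟩, hb⟩ := hw ⟨i, ξ⟩
    refine ⟨_, hm, ?_⟩
    cases m <;> exact hb

/-- A new variable for each disjunct selects it: one clause demands that some disjunct be selected,
and every clause of the `i`-th system is weakened by the literal "`i` is not selected". -/
theorem isClausal_disj (hκ : ℵ₀ ≤ κ) {ι : Type u} (hι : #ι ≤ κ) {D : ι → Set X → Prop}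
    (hD : ∀ i, IsClausal κ (D i)) : IsClausal κ fun A => ∃ i, D i A := by
  choose Θ Ξ hΘ hΞ cl hcl using hD
  refine ⟨ι ⊕ Σ i, Θ i, Option (Σ i, Ξ i), ?_, ?_,
    fun p => p.elim {l | ∃ i, l = (Sum.inr (Sum.inl i), true)} fun p =>
      {l | l = (Sum.inr (Sum.inl p.1), false) ∨
        ∃ m ∈ cl p.1 p.2, l = (Sum.map id (fun t => Sum.inr ⟨p.1, t⟩) m.1, m.2)}, fun A => ?_⟩
  · rw [mk_sum, lift_id, lift_id]
    exact add_le_of_le hκ hι (mk_sigma_le hκ hι hΘ)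
  · rw [mk_option]
    exact add_le_of_le hκ (mk_sigma_le hκ hι hΞ) (one_le_aleph0.trans hκ)
  constructor
  · rintro ⟨i, h⟩
    obtain ⟨w, hw⟩ := (hcl i A).1 h
    refine ⟨{s | s = Sum.inl i ∨ ∃ t ∈ w, s = Sum.inr ⟨i, t⟩}, ?_⟩
    rintro (_ | ⟨j, ξ⟩)
    · exact ⟨_, ⟨i, rfl⟩, by simp⟩
    · by_cases hj : j = i
      · subst hj
        obtain ⟨⟨m, b⟩, hm, hb⟩ := hw ξ
        refine ⟨_, Or.inr ⟨_, hm, rfl⟩, ?_⟩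
        cases m
        · exact hb
        · simpa using hb
      · exact ⟨_, Or.inl rfl, by simp [hj]⟩
  · rintro ⟨w, hw⟩
    obtain ⟨_, ⟨i, rfl⟩, hi⟩ := hw none
    have hi : Sum.inl i ∈ w := by simpa using hi
    refine ⟨i, (hcl i A).2 ⟨{t | Sum.inr ⟨i, t⟩ ∈ w}, fun ξ => ?_⟩⟩
    obtain ⟨_, rfl | ⟨⟨m, b⟩, hm, rfl⟩, hb⟩ := hw (some ⟨i, ξ⟩)
    · simp [hi] at hb
    · refine ⟨_, hm, ?_⟩
      cases m <;> exact hb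

theorem isClausal_mem (hκ : ℵ₀ ≤ κ) (x : X) (b : Bool) :
    IsClausal κ fun A => x ∈ A ↔ b = true := by
  refine ⟨PEmpty, PUnit, by simp, by simpa using one_le_aleph0.trans hκ,
    fun _ => {(Sum.inl x, b)}, fun A => ?_⟩
  constructor
  · intro h
    exact ⟨∅, fun _ => ⟨_, rfl, h⟩⟩
  · rintro ⟨w, hw⟩
    obtain ⟨_, rfl, h⟩ := hw ⟨⟩
    exact h

theorem isClausal_const (hκ : ℵ₀ ≤ κ) (p : Prop) : IsClausal κ fun _ : Set X => p := by
  by_cases hp : p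
  · exact (isClausal_conj hκ (ι := PEmpty) (by simp) (D := fun _ _ => True)
      (fun i => i.elim)).congr (by simp [hp])
  · exact (isClausal_disj hκ (ι := PEmpty) (by simp) (D := fun _ _ => True)
      (fun i => i.elim)).congr (by simp [hp])

/-- The upward projection of a clausal family is clausal. -/
theorem IsClausal.exists_superset (hκ : ℵ₀ ≤ κ) (hX : #X ≤ κ) {D : Set X → Prop}
    (hD : IsClausal κ D) : IsClausal κ fun A => ∃ A', A ⊆ A' ∧ D A' := by
  obtain ⟨Θ, Ξ, hΘ, hΞ, cl, hcl⟩ := hD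
  refine ⟨X ⊕ Θ, X ⊕ Ξ, ?_, ?_,
    -- The larger set becomes auxiliary: each point gets a second variable, and a binary clause
    -- states the inclusion at that point.
    Sum.elim (fun x => {(Sum.inl x, false), (Sum.inr (Sum.inl x), true)})
      fun ξ => {l | ∃ m ∈ cl ξ, l = (Sum.inr m.1, m.2)}, fun A => ?_⟩
  · rw [mk_sum, lift_id, lift_id]
    exact add_le_of_le hκ hX hΘ
  · rw [mk_sum, lift_id, lift_id]
    exact add_le_of_le hκ hX hΞ
  constructor
  · rintro ⟨A', hA, h⟩
    obtain ⟨w, hw⟩ := (hcl A').1 h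
    refine ⟨{s | Sum.elim (· ∈ A') (· ∈ w) s}, ?_⟩
    rintro (x | ξ)
    · by_cases hx : x ∈ A
      · exact ⟨_, Or.inr rfl, by simpa using hA hx⟩
      · exact ⟨_, Or.inl rfl, by simpa using hx⟩
    · obtain ⟨m, hm, hb⟩ := hw ξ
      exact ⟨_, ⟨m, hm, rfl⟩, hb⟩
  · rintro ⟨w, hw⟩
    refine ⟨{x | Sum.inl x ∈ w}, fun x hx => ?_, (hcl _).2 ⟨{t | Sum.inr t ∈ w}, fun ξ => ?_⟩⟩
    · obtain ⟨_, rfl | rfl, h⟩ := hw (Sum.inl x)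
      · simp [hx] at h
      · simpa using h
    · obtain ⟨_, ⟨⟨m, b⟩, hm, rfl⟩, hb⟩ := hw (Sum.inr ξ)
      refine ⟨_, hm, ?_⟩
      cases m <;> exact hb

/-! ### Clausality of the three conditions -/

/-- The value of a term does not depend on the interpretation of the predicate `P`. -/
theorem realize_term_predStructure {L : FirstOrder.Language.{u, u}} (B : L.Structure X) {n : ℕ}
    (A : Set X) (v : Fin n → X) (t : (L.sum predLanguage.{u}).Term (Fin n)) :
    (letI := B; letI := predStructure A; t.realize v) =
      (letI := B; letI := predStructure (∅ : Set X); t.realize v) := by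
  induction t with
  | var => rfl
  | func f ts ih =>
    rcases f with f | f
    · simp only [FirstOrder.Language.Term.realize] at ih ⊢
      simp only [ih]
      rfl
    · exact f.elim

/-- Clausal families are projections, so closure under complement is not available; a formula and
its negation are therefore treated together. Quantifiers become conjunctions and disjunctions over
the at most `κ` points. -/
theorem isClausal_realize (hκ : ℵ₀ ≤ κ) (hX : #X ≤ κ) {L : FirstOrder.Language.{u, u}}
    (B : L.Structure X) {n : ℕ} (φ : InfFormula (L.sum predLanguage.{u}) κ n) (v : Fin n → X) :
    (IsClausal κ fun A : Set X => letI := B; letI := predStructure A; φ.Realize v) ∧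
      IsClausal κ fun A : Set X => letI := B; letI := predStructure A; ¬ φ.Realize v := by
  induction φ with
  | equal s t =>
    simp only [InfFormula.Realize]
    simp only [realize_term_predStructure B]
    exact ⟨isClausal_const hκ _, isClausal_const hκ _⟩
  | rel R ts =>
    simp only [InfFormula.Realize]
    simp only [realize_term_predStructure B]
    rcases R with R | R
    · exact ⟨isClausal_const hκ (B.2 R _), isClausal_const hκ (¬ B.2 R _)⟩
    · cases R
      exact ⟨(isClausal_mem hκ _ true).congr fun A => (iff_true_right rfl).symm,
        (isClausal_mem hκ _ false).congr fun A => (iff_false_right (by simp)).symm⟩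
  | neg φ ih =>
    exact ⟨(ih v).2, (ih v).1.congr fun A => not_not⟩
  | conj hι φ ih =>
    exact ⟨isClausal_conj hκ hι fun i => (ih i v).1,
      (isClausal_disj hκ hι fun i => (ih i v).2).congr fun A => not_forall⟩
  | all φ ih =>
    exact ⟨isClausal_conj hκ hX fun x => (ih _).1,
      (isClausal_disj hκ hX fun x => (ih _).2).congr fun A => not_forall⟩

/-- In the generated case there are at most `κ` finite sets of generators, and lying inside the
union of one of them is a conjunction of negative literals. -/
theorem isClausal_ideal (hκ : ℵ₀ ≤ κ) (hX : #X ≤ κ) {J : Order.Ideal (Set X)}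
    (h : IsGeneratedBy κ J ∨ IsDefinable κ J ∨ IsCofinallyDefinable κ J) :
    IsClausal κ fun A => A ∈ J := by
  rcases h with ⟨G, hG, h⟩ | ⟨L, -, B, ψ, h⟩ | ⟨L, -, B, ψ, h⟩
  · have hF : #(Finset G) ≤ κ := by
      rcases finite_or_infinite G with hfin | hinf
      · exact (mk_lt_aleph0 (α := Finset G)).le.trans hκ
      · rwa [mk_finset_of_infinite]
    refine (isClausal_disj hκ hF fun F => isClausal_conj hκ
      (ι := {x // ∀ S ∈ F, x ∉ (S : Set X)}) ((mk_subtype_le _).trans hX)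
      fun x => isClausal_mem hκ x.1 false).congr fun A => ?_
    rw [h A]
    constructor
    · rintro ⟨F, hFG, hfin, hA⟩
      have hfin' : {S : G | (S : Set X) ∈ F}.Finite := hfin.preimage Subtype.val_injective.injOn
      refine ⟨hfin'.toFinset, fun ⟨x, hx⟩ => ?_⟩
      simp only [Bool.false_eq_true, iff_false]
      intro hxA
      obtain ⟨S, hS, hxS⟩ := hA hxA
      exact hx ⟨S, hFG hS⟩ (by simpa using hS) hxS
    · rintro ⟨F, hF⟩
      refine ⟨Subtype.val '' (F : Set G), ?_, F.finite_toSet.image _, fun x hx => ?_⟩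
      · rintro _ ⟨S, -, rfl⟩
        exact S.2
      · by_contra hc
        have := hF ⟨x, fun S hS hxS => hc ⟨S, ⟨S, hS, rfl⟩, hxS⟩⟩
        simp [hx] at this
  · exact (isClausal_realize hκ hX B ψ _).1.congr h
  · exact ((isClausal_realize hκ hX B ψ _).1.exists_superset hκ hX).congr h

end Clausal

/-! ### Monotonicity of the rank -/

section Rank

variable {X : Type u} {J : Order.Ideal (Set X)}

theorem LtMod.trans {f g h : X → Ordinal.{u}} (hfg : LtMod J f g) (hgh : LtMod J g h) :
    LtMod J f h := by
  refine J.lower (fun x hx => ?_) (Order.Ideal.sup_mem hfg hgh)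
  by_cases h1 : f x < g x
  · exact Or.inr fun h2 => hx (h1.trans h2)
  · exact Or.inl h1

theorem succ_rank_le_of_ltMod (hJ : IsAlephOneComplete J) {g f : X → Ordinal.{u}}
    (h : LtMod J g f) : Order.succ (rank J hJ g) ≤ rank J hJ f := by
  rw [rank_eq J hJ f]
  exact le_csSup (bddAbove_rank J hJ f) ⟨g, h, rfl⟩

theorem exists_ltMod_of_lt_rank (hJ : IsAlephOneComplete J) {f : X → Ordinal.{u}}
    {a : Ordinal.{u}} (h : a < rank J hJ f) : ∃ g, LtMod J g f ∧ a ≤ rank J hJ g := by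
  rw [rank_eq] at h
  have hne : {o | ∃ g, LtMod J g f ∧ o = Order.succ (rank J hJ g)}.Nonempty := by
    by_contra hc
    rw [Set.not_nonempty_iff_eq_empty] at hc
    rw [hc, csSup_empty] at h
    exact not_lt_bot h
  obtain ⟨_, ⟨g, hg, rfl⟩, hag⟩ := exists_lt_of_lt_csSup hne h
  exact ⟨g, hg, Order.lt_succ_iff.1 hag⟩

theorem rank_mono (hJ : IsAlephOneComplete J) {f g : X → Ordinal.{u}}
    (h : {x | ¬ f x ≤ g x} ∈ J) : rank J hJ f ≤ rank J hJ g := by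
  refine le_of_forall_lt fun a ha => ?_
  obtain ⟨k, hk, hak⟩ := exists_ltMod_of_lt_rank hJ ha
  refine hak.trans_lt (Order.succ_le_iff.1 (succ_rank_le_of_ltMod hJ (J.lower ?_
    (Order.Ideal.sup_mem hk h))))
  intro x hx
  by_cases h1 : k x < f x
  · exact Or.inr fun h2 => hx (h1.trans_le h2)
  · exact Or.inl h1

/-- Below a successor, or an ordinal of cofinality greater than `#X`, the rank of the constant
function is approximated by the ranks of smaller constant functions. -/
theorem exists_le_rank_const (hJ : IsAlephOneComplete J) {γ : Ordinal.{u}} (hγ : 1 < γ)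
    (hcof : (∃ β, γ = Order.succ β) ∨ #X < γ.cof) {δ : Ordinal.{u}}
    (hδ : δ < rank J hJ fun _ => γ) : ∃ β, 0 < β ∧ β < γ ∧ δ ≤ rank J hJ fun _ => β := by
  obtain ⟨g, hg, hδg⟩ := exists_ltMod_of_lt_rank hJ hδ
  -- The bound is the predecessor of `γ`, or the supremum of the values below `γ`; the remaining
  -- points form a set of `J`.
  have hbound : ∃ β < γ, ∀ x, g x < γ → g x ≤ β := by
    rcases hcof with ⟨β, rfl⟩ | hcof
    · exact ⟨β, Order.lt_succ β, fun x hx => Order.lt_succ_iff.1 hx⟩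
    · refine ⟨⨆ x, if g x < γ then g x else 0, Ordinal.iSup_lt_of_lt_cof hcof fun x => ?_,
        fun x hx => ?_⟩
      · split_ifs with h
        · exact h
        · exact zero_lt_one.trans hγ
      · refine le_trans ?_ (Ordinal.le_iSup _ x)
        simp [hx]
  obtain ⟨β, hβ, hgβ⟩ := hbound
  -- The maximum with `1` keeps the bound positive, so that a nonempty `P` can be built from it.
  refine ⟨max β 1, zero_lt_one.trans_le (le_max_right _ _), max_lt hβ hγ,
    hδg.trans (rank_mono hJ (J.lower ?_ hg))⟩
  exact fun x hx hlt => hx ((hgβ x hlt).trans (le_max_left _ _))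

end Rank

/-! ### The theory and its types -/

/-- The language with an `n`-ary function symbol for every `n` and every point of `X`, an `n`-ary
relation symbol for every `n` and every element of `Θ`, and one more relation symbol in every arity,
which is `P` in arity one and `<` in arity two. -/
def historyLanguage (X Θ : Type u) : FirstOrder.Language.{u, u} := ⟨fun _ => X, fun _ => Option Θ⟩

section Theory

open FirstOrder FirstOrder.Language

variable {X Θ Ξ : Type u}

theorem card_historyLanguage_le {κ : Cardinal.{u}} (hκ : ℵ₀ ≤ κ) (hX : #X ≤ κ) (hΘ : #Θ ≤ κ) :
    (historyLanguage X Θ).card ≤ κ := by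
  have hnat : #(ULift.{u} ℕ) ≤ κ := by simpa using hκ
  have key : ∀ Y : Type u, #Y ≤ κ → #(Σ _ : ℕ, Y) ≤ κ := fun Y hY =>
    (mk_congr (Equiv.sigmaCongrLeft' (β := fun _ => Y) Equiv.ulift.symm)).trans_le
      (mk_sigma_le hκ hnat fun _ => hY)
  have h := mk_sum (Σ _ : ℕ, X) (Σ _ : ℕ, Option Θ)
  rw [lift_id, lift_id] at h
  refine h.trans_le (add_le_of_le hκ (key _ hX) (key _ ?_))
  rw [mk_option]
  exact add_le_of_le hκ hΘ (one_le_aleph0.trans hκ)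

/-- The symbol `<`. -/
abbrev ltSymbol (X Θ : Type u) : (historyLanguage X Θ).Relations 2 := (none : Option Θ)

/-- The symbol `P`. -/
abbrev predSymbol (X Θ : Type u) : (historyLanguage X Θ).Relations 1 := (none : Option Θ)

/-- The function symbol of a given arity belonging to a point of `X`. -/
abbrev valueSymbol (Θ : Type u) {X : Type u} (n : ℕ) (i : X) :
    (historyLanguage X Θ).Functions n := i

/-- The relation symbol of a given arity belonging to an element of `Θ`. -/
abbrev witnessSymbol (X : Type u) {Θ : Type u} (n : ℕ) (t : Θ) :
    (historyLanguage X Θ).Relations n := some t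

/-- Trichotomy of a binary relation symbol as a sentence. -/
def trichotomousSentence {L : FirstOrder.Language.{u, u}} (r : L.Relations 2) : L.Sentence :=
  BoundedFormula.all (BoundedFormula.all (r.boundedFormula₂ (&0) (&1) ⊔
    (Term.bdEqual (&0) (&1) ⊔ r.boundedFormula₂ (&1) (&0))))

/-- The theory of strict linear orders. -/
def strictLinearOrderTheory {L : FirstOrder.Language.{u, u}} (r : L.Relations 2) : L.Theory :=
  {r.irreflexive, r.transitive, trichotomousSentence r}

theorem model_strictLinearOrderTheory {L : FirstOrder.Language.{u, u}} (r : L.Relations 2)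
    (M : Type u) [L.Structure M] :
    M ⊨ strictLinearOrderTheory r ↔ IsStrictTotalOrder M (ltRel r M) := by
  have htri : M ⊨ trichotomousSentence r ↔
      ∀ x y : M, ltRel r M x y ∨ x = y ∨ ltRel r M y x := by
    refine forall₂_congr fun x y => ?_
    simp only [BoundedFormula.realize_sup, BoundedFormula.realize_rel₂,
      BoundedFormula.realize_bdEqual]
    rfl
  simp only [strictLinearOrderTheory, Theory.model_iff, Set.mem_insert_iff, Set.mem_singleton_iff,
    forall_eq_or_imp, forall_eq, Relations.realize_irreflexive, Relations.realize_transitive, htri]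
  constructor
  · rintro ⟨h1, h2, h3⟩
    exact { irrefl := h1.irrefl, trans := h2.trans
            trichotomous := fun a b ha hb => ((h3 a b).resolve_left ha).resolve_right hb }
  · intro h
    refine ⟨⟨h.irrefl⟩, ⟨h.trans⟩, fun a b => ?_⟩
    by_contra! hc
    exact hc.2.1 (h.trichotomous a b hc.1 hc.2.2)

/-- The points at which the value of the last history is not below that of its predecessor. -/
def failureSet (Θ : Type u) {X M : Type u} [(historyLanguage X Θ).Structure M] {n : ℕ}
    (v : Fin (n + 1) → M) : Set X :=
  {i | ¬ ltRel (ltSymbol X Θ) M (Structure.funMap (valueSymbol Θ (n + 1) i) v)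
    (Structure.funMap (valueSymbol Θ n i) fun k => v k.castSucc)}

/-- The auxiliary truth values attached to a history. -/
def witnessSet (X : Type u) {Θ M : Type u} [(historyLanguage X Θ).Structure M] {n : ℕ}
    (v : Fin n → M) : Set Θ :=
  {t | Structure.RelMap (witnessSymbol X n t) v}

/-- The formula defining `failureSet` or `witnessSet`. -/
def variableFormula (n : ℕ) :
    X ⊕ Θ → (historyLanguage X Θ).Formula (Fin (n + 1))
  | .inl i => ∼((ltSymbol X Θ).formula₂ (Term.func (valueSymbol Θ (n + 1) i) Term.var)
      (Term.func (valueSymbol Θ n i) fun k => Term.var k.castSucc))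
  | .inr t => (witnessSymbol X (n + 1) t).formula Term.var

/-- A literal as a formula. -/
def literalFormula (n : ℕ) (l : (X ⊕ Θ) × Bool) : (historyLanguage X Θ).Formula (Fin (n + 1)) :=
  if l.2 then variableFormula n l.1 else ∼(variableFormula n l.1)

theorem realize_literalFormula {M : Type u} [(historyLanguage X Θ).Structure M] {n : ℕ}
    (l : (X ⊕ Θ) × Bool) (v : Fin (n + 1) → M) :
    (literalFormula n l).Realize v ↔
      (Sum.elim (· ∈ failureSet Θ v) (· ∈ witnessSet X v) l.1 ↔ l.2 = true) := by
  have h : ∀ s : X ⊕ Θ, (variableFormula n s).Realize v ↔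
      Sum.elim (· ∈ failureSet Θ v) (· ∈ witnessSet X v) s := by
    rintro (i | t)
    · exact (Formula.realize_not).trans (not_congr Formula.realize_rel₂)
    · exact Formula.realize_rel
  obtain ⟨s, b⟩ := l
  cases b
  · simpa [literalFormula, Formula.realize_not] using not_congr (h s)
  · simpa [literalFormula] using h s

/-- The type of a descending sequence outside `P` that violates a clause. -/
def clauseType (cl : Ξ → Set ((X ⊕ Θ) × Bool)) (n : ℕ) (ξ : Ξ) :
    PartialType (historyLanguage X Θ) :=
  -- At least two entries, so that both compared histories are nonempty: in the intended model the
  -- empty history is the constant `β`, which is not itself an element of `β`.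
  ⟨n + 2, {φ | (∃ k : Fin (n + 1), φ = (ltSymbol X Θ).formula₂ (Term.var k.succ)
      (Term.var k.castSucc)) ∨
    (∃ k : Fin (n + 2), φ = ∼((predSymbol X Θ).formula₁ (Term.var k))) ∨
    ∃ l ∈ cl ξ, φ = ∼(literalFormula (n + 1) l)}⟩

/-- The type of a sequence with a value outside `P`. -/
def valueType (Θ : Type u) {X : Type u} (n : ℕ) (i : X) : PartialType (historyLanguage X Θ) :=
  ⟨n, {∼((predSymbol X Θ).formula₁ (Term.func (valueSymbol Θ n i) Term.var))}⟩

/-- The types to be omitted. -/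
def omittedTypes (cl : Ξ → Set ((X ⊕ Θ) × Bool)) : Set (PartialType (historyLanguage X Θ)) :=
  Set.range fun p : (ℕ × Ξ) ⊕ (ℕ × X) =>
    p.elim (fun q => clauseType cl q.1 q.2) fun q => valueType Θ q.1 q.2

theorem mk_omittedTypes_le {κ : Cardinal.{u}} (hκ : ℵ₀ ≤ κ) (hX : #X ≤ κ) (hΞ : #Ξ ≤ κ)
    (cl : Ξ → Set ((X ⊕ Θ) × Bool)) : #(omittedTypes cl) ≤ κ := by
  refine mk_range_le.trans ?_
  simp only [mk_sum, mk_prod, lift_id, mk_nat, lift_aleph0, lift_uzero]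
  exact add_le_of_le hκ (mul_le_of_le hκ hκ hΞ) (mul_le_of_le hκ hκ hX)

/-- The dictionary between types and clauses: a tuple fails a type by refuting one of its formulas,
which for a descending tuple outside `P` must be a negated literal of the clause. -/
theorem memEC_iff (cl : Ξ → Set ((X ⊕ Θ) × Bool)) (M : Type u)
    [(historyLanguage X Θ).Structure M] :
    MemEC (strictLinearOrderTheory (ltSymbol X Θ)) (omittedTypes cl) M ↔
      Nonempty M ∧ IsStrictTotalOrder M (ltRel (ltSymbol X Θ) M) ∧
      (∀ (n : ℕ) (v : Fin (n + 2) → M),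
        (∀ k : Fin (n + 1), ltRel (ltSymbol X Θ) M (v k.succ) (v k.castSucc)) →
        (∀ k, v k ∉ predSet (predSymbol X Θ) M) →
        SatClauses cl (failureSet Θ v) (witnessSet X v)) ∧
      ∀ (n : ℕ) (i : X) (v : Fin n → M),
        Structure.funMap (valueSymbol Θ n i) v ∈ predSet (predSymbol X Θ) M := by
  have hcl : ∀ (n : ℕ) (ξ : Ξ), (∀ v : Fin (n + 2) → M,
      ∃ φ ∈ (clauseType cl n ξ).2, ¬ Formula.Realize φ v) ↔ ∀ v : Fin (n + 2) → M,
      (∀ k : Fin (n + 1), ltRel (ltSymbol X Θ) M (v k.succ) (v k.castSucc)) →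
      (∀ k, v k ∉ predSet (predSymbol X Θ) M) →
      ∃ l ∈ cl ξ, (Sum.elim (· ∈ failureSet Θ v) (· ∈ witnessSet X v) l.1 ↔ l.2 = true) := by
    refine fun n ξ => forall_congr' fun v => ?_
    constructor
    · rintro ⟨_, ⟨k, rfl⟩ | ⟨k, rfl⟩ | ⟨l, hl, rfl⟩, hφ⟩ h1 h2
      · exact absurd (Formula.realize_rel₂.2 (h1 k)) hφ
      · exact absurd (Formula.realize_not.2 (mt Formula.realize_rel₁.1 (h2 k))) hφ
      · exact ⟨l, hl, (realize_literalFormula l v).1 (not_not.1 (mt Formula.realize_not.2 hφ))⟩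
    · intro h
      by_contra! hc
      obtain ⟨l, hl, h3⟩ := h (fun k => Formula.realize_rel₂.1 (hc _ (Or.inl ⟨k, rfl⟩)))
        fun k hk => Formula.realize_not.1 (hc _ (Or.inr (Or.inl ⟨k, rfl⟩)))
          (Formula.realize_rel₁.2 hk)
      exact Formula.realize_not.1 (hc _ (Or.inr (Or.inr ⟨l, hl, rfl⟩)))
        ((realize_literalFormula l v).2 h3)
  have hval : ∀ (n : ℕ) (i : X), (∀ v : Fin n → M,
      ∃ φ ∈ (valueType Θ n i).2, ¬ Formula.Realize φ v) ↔ ∀ v : Fin n → M,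
        Structure.funMap (valueSymbol Θ n i) v ∈ predSet (predSymbol X Θ) M := by
    refine fun n i => forall_congr' fun v => ?_
    constructor
    · rintro ⟨_, rfl, hφ⟩
      exact Formula.realize_rel₁.1 (not_not.1 (mt Formula.realize_not.2 hφ))
    · exact fun h => ⟨_, rfl, fun hc => Formula.realize_not.1 hc (Formula.realize_rel₁.2 h)⟩
  rw [MemEC, model_strictLinearOrderTheory]
  refine and_congr_right fun _ => and_congr_right fun _ => ?_
  rw [omittedTypes, Set.forall_mem_range, Sum.forall, Prod.forall, Prod.forall]
  refine and_congr (forall_congr' fun n => ?_) (forall₂_congr hval)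
  exact (forall_congr' (hcl n)).trans
    ⟨fun h v h1 h2 ξ => h ξ v h1 h2, fun h ξ v h1 h2 => h v h1 h2 ξ⟩

/-- If `P` is well ordered in a model, then so is its complement. -/
theorem isWellOrder_compl_of_memEC {J : Order.Ideal (Set X)} (hJ : IsAlephOneComplete J)
    {cl : Ξ → Set ((X ⊕ Θ) × Bool)} (hcl : ∀ A w, SatClauses cl A w → A ∈ J)
    {N : Type u} [(historyLanguage X Θ).Structure N]
    (hN : MemEC (strictLinearOrderTheory (ltSymbol X Θ)) (omittedTypes cl) N)
    (hP : IsWellOrder (predSet (predSymbol X Θ) N)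
      (Subrel (ltRel (ltSymbol X Θ) N) (· ∈ predSet (predSymbol X Θ) N))) :
    IsWellOrder ↑(predSet (predSymbol X Θ) N)ᶜ
      (Subrel (ltRel (ltSymbol X Θ) N) (· ∈ (predSet (predSymbol X Θ) N)ᶜ)) := by
  obtain ⟨-, hord, hclause, hvalue⟩ := (memEC_iff cl N).1 hN
  have hwf : WellFounded
      (Subrel (ltRel (ltSymbol X Θ) N) (· ∈ (predSet (predSymbol X Θ) N)ᶜ)) := by
    rw [wellFounded_iff_isEmpty_descending_chain]
    refine ⟨fun ⟨a, ha⟩ => ?_⟩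
    have hmem := fun n => hcl _ _ (hclause n (fun k => (a k).1) (fun k => ha k) fun k => (a k).2)
    -- Here `ℵ₁`-completeness and properness give a point at which every step of the descent
    -- succeeds.
    have hunion := hJ.iUnion_mem _ hmem
    obtain ⟨i, hi⟩ := (Set.ne_univ_iff_exists_notMem _).1
      fun hu => hJ.proper (hu ▸ hunion)
    simp only [failureSet, Set.mem_iUnion, Set.mem_ofPred_eq, not_exists, not_not] at hi
    exact (wellFounded_iff_isEmpty_descending_chain.1 hP.wf).false
      ⟨fun n => ⟨_, hvalue (n + 1) i fun k => (a k).1⟩, fun n => hi n⟩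
  exact { wf := hwf
          trichotomous := fun x y hxy hyx => Subtype.ext (hord.trichotomous _ _ hxy hyx) }

end Theory

/-! ### Models from iterated descent -/

section Model

open FirstOrder FirstOrder.Language

variable {X Θ Ξ : Type u}

/-- Iterating `step` along a sequence of ordinals. -/
def history (step : (X → Ordinal.{u}) → Ordinal.{u} → X → Ordinal.{u}) (f : X → Ordinal.{u})
    (a : ℕ → Ordinal.{u}) : ℕ → X → Ordinal.{u}
  | 0 => f
  | n + 1 => step (history step f a n) (a n)

theorem history_congr (step : (X → Ordinal.{u}) → Ordinal.{u} → X → Ordinal.{u})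
    (f : X → Ordinal.{u}) {a b : ℕ → Ordinal.{u}} {n : ℕ} (h : ∀ k < n, a k = b k) :
    history step f a n = history step f b n := by
  induction n with
  | zero => rfl
  | succ n ih =>
    rw [history, history, ih fun k hk => h k (hk.trans n.lt_succ_self), h n n.lt_succ_self]

/-- The rank bound is the invariant: after step `n` the rank is at least `a n`, hence above `a (n +
1)`, so `step` applies again. -/
theorem ltMod_history {J : Order.Ideal (Set X)} (hJ : IsAlephOneComplete J)
    {step : (X → Ordinal.{u}) → Ordinal.{u} → X → Ordinal.{u}}
    (hstep : ∀ f a, a < rank J hJ f → LtMod J (step f a) f ∧ a ≤ rank J hJ (step f a))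
    {f : X → Ordinal.{u}} {a : ℕ → Ordinal.{u}} (h0 : a 0 < rank J hJ f) {n : ℕ}
    (h : ∀ k < n, a (k + 1) < a k) :
    LtMod J (history step f a (n + 1)) (history step f a n) ∧
      a n ≤ rank J hJ (history step f a (n + 1)) ∧ LtMod J (history step f a (n + 1)) f := by
  induction n with
  | zero => exact ⟨(hstep _ _ h0).1, (hstep _ _ h0).2, (hstep _ _ h0).1⟩
  | succ n ih =>
    obtain ⟨-, h2, h3⟩ := ih fun k hk => h k (hk.trans n.lt_succ_self)
    obtain ⟨h4, h5⟩ := hstep _ _ ((h n n.lt_succ_self).trans_le h2)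
    exact ⟨h4, h5, h4.trans h3⟩

variable {β ρ : Ordinal.{u}}

/-- The ordinal of a point of the second summand. -/
noncomputable def rightOrd : β.ToType ⊕ ρ.ToType → Ordinal.{u} :=
  Sum.elim (fun _ => 0) fun x => x.toOrd

/-- The ordinals of a finite sequence, continued by zero. -/
noncomputable def sequenceOrd {n : ℕ} (v : Fin n → β.ToType ⊕ ρ.ToType) (k : ℕ) : Ordinal.{u} :=
  if h : k < n then rightOrd (v ⟨k, h⟩) else 0

/-- An ordinal as an element of `β.ToType`, with the junk value `0` if it is not below `β`. -/
noncomputable def truncate (hβ : 0 < β) (o : Ordinal.{u}) : β.ToType :=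
  if h : o < β then Ordinal.ToType.mk ⟨o, h⟩ else Ordinal.ToType.mk ⟨0, hβ⟩

theorem truncate_lt_truncate (hβ : 0 < β) {o p : Ordinal.{u}} (hp : p < β) (h : o < p) :
    truncate hβ o < truncate hβ p := by
  rw [truncate, truncate, dif_pos hp, dif_pos (h.trans hp), OrderIso.lt_iff_lt]
  exact h

/-- The value of a history at a point. -/
noncomputable def historyValue (ρ : Ordinal.{u}) (hβ : 0 < β)
    (step : (X → Ordinal.{u}) → Ordinal.{u} → X → Ordinal.{u})
    (i : X) {n : ℕ} (v : Fin n → β.ToType ⊕ ρ.ToType) : β.ToType ⊕ ρ.ToType :=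
  Sum.inl (truncate hβ (history step (fun _ => β) (sequenceOrd v) n i))

/-- The set of points at which a history does not descend. -/
def historyFailure (ρ : Ordinal.{u}) (hβ : 0 < β)
    (step : (X → Ordinal.{u}) → Ordinal.{u} → X → Ordinal.{u}) :
    {n : ℕ} → (Fin n → β.ToType ⊕ ρ.ToType) → Set X
  -- A default value, needed because the witness predicates exist in every arity; no clause is
  -- imposed on the empty sequence.
  | 0, _ => ∅
  | n + 1, v => {i | ¬ Sum.Lex (· < ·) (· < ·) (historyValue ρ hβ step i v)
      (historyValue ρ hβ step i fun k : Fin n => v k.castSucc)}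

open Classical in
/-- Auxiliary truth values satisfying the clauses together with `A`, if there are any. -/
noncomputable def someWitness (cl : Ξ → Set ((X ⊕ Θ) × Bool)) (A : Set X) : Set Θ :=
  if h : ∃ w, SatClauses cl A w then h.choose else ∅

/-- The ordinal `β` followed by `ρ`, with the values of all histories. -/
noncomputable abbrev historyStructure (ρ : Ordinal.{u}) (hβ : 0 < β)
    (step : (X → Ordinal.{u}) → Ordinal.{u} → X → Ordinal.{u})
    (cl : Ξ → Set ((X ⊕ Θ) × Bool)) :
    (historyLanguage X Θ).Structure (β.ToType ⊕ ρ.ToType) where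
  funMap := fun i v => historyValue ρ hβ step i v
  RelMap := fun {n} R v => match R with
    | some t => t ∈ someWitness cl (historyFailure ρ hβ step v)
    | none => (∃ h : n = 1, (v ⟨0, by omega⟩).isLeft) ∨
        ∃ h : n = 2, Sum.Lex (· < ·) (· < ·) (v ⟨0, by omega⟩) (v ⟨1, by omega⟩)

/-- Outside a set of `J` the last step descends and starts from a value below `β`; there truncation
changes neither value. -/
theorem historyFailure_mem {J : Order.Ideal (Set X)} (hJ : IsAlephOneComplete J) (hβ : 0 < β)
    {step : (X → Ordinal.{u}) → Ordinal.{u} → X → Ordinal.{u}}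
    (hstep : ∀ f a, a < rank J hJ f → LtMod J (step f a) f ∧ a ≤ rank J hJ (step f a))
    {n : ℕ} (v : Fin (n + 2) → β.ToType ⊕ (rank J hJ fun _ => β).ToType)
    (hv : ∀ k : Fin (n + 1), Sum.Lex (· < ·) (· < ·) (v k.succ) (v k.castSucc))
    (hright : ∀ k, ¬ (v k).isLeft) :
    historyFailure (rank J hJ fun _ => β) hβ step v ∈ J := by
  have hord : ∀ k (hk : k < n + 2), sequenceOrd v k = rightOrd (v ⟨k, hk⟩) := fun k hk => by
    rw [sequenceOrd, dif_pos hk]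
  have hdesc : ∀ k < n + 1, sequenceOrd v (k + 1) < sequenceOrd v k := by
    intro k hk
    rw [hord k (by omega), hord (k + 1) (by omega)]
    have h1 := hright ⟨k, by omega⟩
    have h2 := hright ⟨k + 1, by omega⟩
    have h3 : Sum.Lex (· < ·) (· < ·) (v ⟨k + 1, by omega⟩) (v ⟨k, by omega⟩) := hv ⟨k, hk⟩
    generalize v ⟨k, by omega⟩ = x at *
    generalize v ⟨k + 1, by omega⟩ = y at *
    rcases x with x | x
    · simp at h1
    rcases y with y | y
    · simp at h2
    rw [Sum.lex_inr_inr] at h3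
    exact Ordinal.ToType.mk.symm.lt_iff_lt.2 h3
  have h0 : sequenceOrd v 0 < rank J hJ fun _ => β := by
    rw [hord 0 (by omega)]
    have h1 := hright ⟨0, by omega⟩
    generalize v ⟨0, by omega⟩ = x at *
    rcases x with x | x
    · simp at h1
    · exact x.toOrd.2
  obtain ⟨h1, -, -⟩ := ltMod_history hJ hstep h0 hdesc
  -- The earlier of the two histories is already below the constant `β` modulo `J`, as
  -- `truncate_lt_truncate` requires.
  obtain ⟨-, -, h2⟩ := ltMod_history hJ hstep h0 fun k hk => hdesc k (Nat.lt_succ_of_lt hk)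
  refine J.lower (fun i hi => ?_) (Order.Ideal.sup_mem h1 h2)
  by_contra hc
  replace hc := not_or.1 hc
  simp only [Set.mem_ofPred_eq, not_not] at hc
  refine hi ?_
  -- Dropping the last entry does not affect the history of length `n + 1`.
  have hpred : history step (fun _ => β) (sequenceOrd fun k : Fin (n + 1) => v k.castSucc) (n + 1) =
      history step (fun _ => β) (sequenceOrd v) (n + 1) := by
    refine history_congr _ _ fun k hk => ?_
    rw [sequenceOrd, dif_pos hk, hord k (by omega)]
    rfl
  rw [historyValue, historyValue, hpred, Sum.lex_inl_inl]
  exact truncate_lt_truncate hβ hc.2 hc.1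

/-- Stated for a relation and a set merely equal to the expected ones, so that it applies to the
interpretations of `<` and `P` after rewriting them once. -/
theorem exists_wellOrder_sum (r : β.ToType ⊕ ρ.ToType → β.ToType ⊕ ρ.ToType → Prop)
    (S : Set (β.ToType ⊕ ρ.ToType)) (hr : r = Sum.Lex (· < ·) (· < ·))
    (hS : S = {x | x.isLeft}) :
    (∃ _ : IsWellOrder S (Subrel r (· ∈ S)), Ordinal.type (Subrel r (· ∈ S)) ≤ β) ∧
      ∃ _ : IsWellOrder ↑Sᶜ (Subrel r (· ∈ Sᶜ)), ρ ≤ Ordinal.type (Subrel r (· ∈ Sᶜ)) := by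
  subst hr hS
  refine ⟨⟨inferInstance, ?_⟩, ⟨inferInstance, ?_⟩⟩
  · conv_rhs => rw [← Ordinal.type_toType β]
    refine RelEmbedding.ordinal_type_le ⟨⟨fun x => x.1.getLeft x.2, ?_⟩, ?_⟩
    · rintro ⟨x | x, hx⟩ ⟨y | y, hy⟩ h
      · simpa using h
      all_goals simp at hx hy
    · rintro ⟨x | x, hx⟩ ⟨y | y, hy⟩
      · simp [Subrel]
      all_goals simp at hx hy
  · conv_lhs => rw [← Ordinal.type_toType ρ]
    refine RelEmbedding.ordinal_type_le ⟨⟨fun x => ⟨Sum.inr x, by simp⟩, ?_⟩, ?_⟩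
    · intro x y h
      simpa using h
    · intro x y
      exact Sum.lex_inr_inr

theorem exists_model {J : Order.Ideal (Set X)} (hJ : IsAlephOneComplete J)
    {cl : Ξ → Set ((X ⊕ Θ) × Bool)} (hcl : ∀ A ∈ J, ∃ w, SatClauses cl A w) (hβ : 0 < β) :
    ∃ (M : Type u) (_ : (historyLanguage X Θ).Structure M),
      MemEC (strictLinearOrderTheory (ltSymbol X Θ)) (omittedTypes cl) M ∧
      (∃ _ : IsWellOrder (predSet (predSymbol X Θ) M)
          (Subrel (ltRel (ltSymbol X Θ) M) (· ∈ predSet (predSymbol X Θ) M)),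
        Ordinal.type (Subrel (ltRel (ltSymbol X Θ) M) (· ∈ predSet (predSymbol X Θ) M)) ≤ β) ∧
      ∃ _ : IsWellOrder ↑(predSet (predSymbol X Θ) M)ᶜ
          (Subrel (ltRel (ltSymbol X Θ) M) (· ∈ (predSet (predSymbol X Θ) M)ᶜ)),
        (rank J hJ fun _ => β) ≤ Ordinal.type
          (Subrel (ltRel (ltSymbol X Θ) M) (· ∈ (predSet (predSymbol X Θ) M)ᶜ)) := by
  -- A total choice of descents; where `a` is not below the rank, `f` itself serves as a default.
  have hex : ∀ (f : X → Ordinal.{u}) (a : Ordinal.{u}), ∃ g, a < rank J hJ f →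
      LtMod J g f ∧ a ≤ rank J hJ g := by
    intro f a
    by_cases h : a < rank J hJ f
    · obtain ⟨g, hg⟩ := exists_ltMod_of_lt_rank hJ h
      exact ⟨g, fun _ => hg⟩
    · exact ⟨f, fun h' => absurd h' h⟩
  choose step hstep using hex
  let str := historyStructure (rank J hJ fun _ => β) hβ step cl
  have hlt : ltRel (ltSymbol X Θ) (β.ToType ⊕ (rank J hJ fun _ => β).ToType) =
      Sum.Lex (· < ·) (· < ·) := by
    ext x y
    exact ⟨fun h => h.elim (fun h => absurd h.1 (by decide)) fun h => h.2,
      fun h => Or.inr ⟨rfl, h⟩⟩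
  have hP : predSet (predSymbol X Θ) (β.ToType ⊕ (rank J hJ fun _ => β).ToType) =
      {x | x.isLeft} := by
    ext x
    exact ⟨fun h => h.elim (fun h => h.2) fun h => absurd h.1 (by decide),
      fun h => Or.inl ⟨rfl, h⟩⟩
  refine ⟨_, str, (memEC_iff cl _).2 ⟨⟨Sum.inl (truncate hβ 0)⟩, ?_, ?_, ?_⟩,
    exists_wellOrder_sum _ _ hlt hP⟩
  · rw [hlt]
    infer_instance
  · intro n v hv hright
    have hfail : failureSet Θ v = historyFailure (rank J hJ fun _ => β) hβ step v := by
      rw [failureSet, hlt]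
      rfl
    have hwit : witnessSet X v =
        someWitness cl (historyFailure (rank J hJ fun _ => β) hβ step v) := rfl
    rw [hlt] at hv
    simp only [hP] at hright
    -- Failure sets of descending sequences lie in `J`, so the witness chosen in the structure does
    -- solve the clauses.
    have h := hcl _ (historyFailure_mem hJ hβ hstep v hv hright)
    rw [hfail, hwit, someWitness, dif_pos h]
    exact h.choose_spec
  · intro n i v
    rw [hP]
    rfl

end Model

/-! ### Comparison with `δ₂` -/

theorem not_deltaTwoProperty {κ : Cardinal.{u}} (hκ : ℵ₀ ≤ κ) {X : Type u} (hX : #X ≤ κ)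
    {J : Order.Ideal (Set X)} (hJ : IsAlephOneComplete J) (hdef : IsClausal κ fun A => A ∈ J)
    {γ δ : Ordinal.{u}}
    (hδ : ∀ δ' < δ, ∃ β, 0 < β ∧ β < γ ∧ δ' ≤ rank J hJ fun _ => β) :
    ¬ DeltaTwoProperty γ κ δ := by
  obtain ⟨Θ, Ξ, hΘ, hΞ, cl, hcl⟩ := hdef
  intro hprop
  obtain ⟨N, _, hN, ⟨hP, -⟩, hnot⟩ := hprop (historyLanguage X Θ)
    (strictLinearOrderTheory (ltSymbol X Θ)) (ltSymbol X Θ) (predSymbol X Θ) (omittedTypes cl)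
    (card_historyLanguage_le hκ hX hΘ) (mk_omittedTypes_le hκ hX hΞ cl)
    (fun M _ _ hM => (model_strictLinearOrderTheory _ M).1 hM) (by
      intro δ' hδ'
      obtain ⟨β, hβ, hβγ, hle⟩ := hδ δ' hδ'
      obtain ⟨M, str, hM, ⟨h1, h2⟩, h3, h4⟩ := exists_model hJ (fun A hA => (hcl A).1 hA) hβ
      exact ⟨M, str, hM, ⟨h1, h2.trans_lt hβγ⟩, h3, hle.trans h4⟩)
  -- Well-orderedness of `P` in `N` alone is contradictory; the bound `κ⁺` on its order type plays
  -- no role.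
  exact hnot (isWellOrder_compl_of_memEC hJ (fun A w hw => (hcl A).2 ⟨w, hw⟩) hN hP)

theorem DeltaTwoProperty.mono {γ δ ε : Ordinal.{u}} {κ : Cardinal.{u}}
    (h : DeltaTwoProperty γ κ δ) (hδ : δ ≤ ε) : DeltaTwoProperty γ κ ε :=
  fun L T lt P Γ h1 h2 h3 h4 => h L T lt P Γ h1 h2 h3 fun δ' hδ' => h4 δ' (hδ'.trans_le hδ)

/-- The property passes to larger ordinals, so failure at `δ` puts every instance at or above the
successor of `δ`; with no instances the infimum is `⊤`. -/
theorem lt_deltaTwo {γ δ : Ordinal.{u}} {κ : Cardinal.{u}} (h : ¬ DeltaTwoProperty γ κ δ) :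
    (δ : WithTop Ordinal.{u}) < deltaTwo γ κ := by
  refine (WithTop.coe_lt_coe.2 (Order.lt_succ δ)).trans_le (le_sInf ?_)
  rintro _ ⟨ε, rfl, hε⟩
  rw [WithTop.coe_le_coe, Order.succ_le_iff]
  by_contra! hc
  exact h (hε.mono hc)

end GalvinHajnal

theorem mainTheorem4 (κ : Cardinal.{u}) (hκ : ℵ₀ ≤ κ) (X : Type u) (hX : #X = κ)
    (J : Order.Ideal (Set X)) (hJ : GalvinHajnal.IsAlephOneComplete J)
    (hdef : GalvinHajnal.IsGeneratedBy κ J ∨ GalvinHajnal.IsDefinable κ J ∨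
      GalvinHajnal.IsCofinallyDefinable κ J)
    (γ : Ordinal.{u}) (hγ : κ.ord < γ) :
    ((GalvinHajnal.rank J hJ (fun _ => γ) : Ordinal.{u}) : WithTop Ordinal.{u})
        < GalvinHajnal.deltaTwo (Order.succ γ) κ ∧
      ((∃ β, γ = Order.succ β) ∨ κ < γ.cof →
        ((GalvinHajnal.rank J hJ (fun _ => γ) : Ordinal.{u}) : WithTop Ordinal.{u})
          < GalvinHajnal.deltaTwo γ κ) := by
  have hclausal := GalvinHajnal.isClausal_ideal hκ hX.le hdef
  have hγ1 : 1 < γ := by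
    refine lt_of_le_of_lt ?_ hγ
    rw [← Cardinal.ord_one]
    exact Cardinal.ord_le_ord.2 (one_le_aleph0.trans hκ)
  -- For `γ + 1` the single choice `β = γ` serves all `δ` below the rank; for `γ` itself, `β` varies
  -- with `δ`.
  refine ⟨GalvinHajnal.lt_deltaTwo (GalvinHajnal.not_deltaTwoProperty hκ hX.le hJ hclausal
    fun δ hδ => ⟨γ, zero_lt_one.trans hγ1, Order.lt_succ γ, hδ.le⟩), fun h => ?_⟩
  subst hX
  exact GalvinHajnal.lt_deltaTwo (GalvinHajnal.not_deltaTwoProperty hκ le_rfl hJ hclausal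
    fun δ hδ => GalvinHajnal.exists_le_rank_const hJ hγ1 h hδ)
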